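/- A network is a triple $(X,\omega_X,\mu_X)$ with $X$ a Polish space, $\mu_X$ a fully supported Borel probability measure on $X$ and $\omega_X\in L^2(X\times X,\mu_X\otimes\mu_X)$. The Gromov–Wasserstein distance is $$GW(\mathbb X,\mathbb Y)=\inf_{\pi\in\Pi(\mu_X,\mu_Y)}\Big(\iint|\omega_X(x,x')-\omega_Y(y,y')|^2\,d\pi(x,y)\,d\pi(x',y')\Big)^{1/2}.$$ A common resolution of $\mathbb X$ and $\mathbb Y$ is a Borel probability space $(Z,\mu_Z)$ with measure preserving maps $\varphi_X:Z\to X$, $\varphi_Y:Z\to Y$ such that $\varphi_X^*\omega_X=\varphi_Y^*\omega_Y$ $\mu_Z\otimes\mu_Z$-a.e.; the networks are weakly isomorphic if one exists, and $[\mathbb Y]$ is the weak isomorphism class of $\mathbb Y$. The tangent space at $[\mathbb Y]$ is $\mathrm{Tan}_{[\mathbb Y]}=\big(\bigcup_{(Y',\omega',\mu')\in[\mathbb Y]}L^2(Y'\times Y',\mu'\otimes\mu')\big)/\simeq$, where $v\simeq v'$ if there is a coupling $\pi$ of the two base measures such that, $\pi\otimes\pi$-almost everywhere, both the weight functions and the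 vectors $v,v'$ agree. Its inner product is $\langle[v],[v']\rangle=\langle\varphi^*v,\varphi'^*v'\rangle_{L^2(Z\times Z,\mu_Z\otimes\mu_Z)}$ for a common resolution $(Z,\varphi,\varphi')$ of the base networks of $v$ and $v'$; an equation $\langle[v],[v']\rangle=c$ means that the right-hand side equals $c$ for all representatives and all common resolutions. We write $\|\xi\|^2=\langle\xi,\xi\rangle$. For $v\in L^2(Y'\times Y',\mu'\otimes\mu')$ put $Exp_{[\mathbb Y]}([tv])=[(Y',\omega'+tv,\mu')]$. A vector $\gamma\in\mathrm{Tan}_{[\mathbb Y]}$ is the gradient $\nabla G([\mathbb Y])$ of a functional $G$ if for every $[v]\in\mathrm{Tan}_{[\mathbb Y]}$ the directional derivative $D_vG([\mathbb Y])=\lim_{t\searrow0}\frac1t\big(G(Exp_{[\mathbb Y]}([tv]))-G([\mathbb Y])\big)$ exists and $D_vG([\mathbb Y])=\langle[v],\gamma\rangle$. A finite network $(\mathbf X,\mathrm p)$ consists of a real $N\times N$ matrix $\mathbf X$ and a probability vector $\mathrm p$ with positive entries. Given finite templates $\mathbb X^s=(\mathbf X^s,\mathrm p^s)$, $s=1,\dots,S$,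 and a finite network $\mathbb Y=(\mathbf Y,\mathrm q)$, an optimal blow-up with respect to $\mathbb Y$ is obtained as follows. Start with $(\mathbf Y_b,\mathrm q_b)=(\mathbf Y,\mathrm q)$. For $s=1,\dots,S$: take a coupling $\pi$ of $\mathrm p^s$ and $\mathrm q_b$ that minimizes $\sum_{i,j,k,l}|\mathbf X^s_{ik}-(\mathbf Y_b)_{jl}|^2\pi_{ij}\pi_{kl}$; enumerate the non-zero entries of $\pi$ as $(v_X[l],v_Y[l])$, $l=1,\dots,M_b$; set $\mathbf X^s_b[i,j]=\mathbf X^s[v_X[i],v_X[j]]$; replace $\mathbf Y_b$ and every previously computed $\mathbf X^r_b$ ($r<s$) by the matrix with entries $\mathbf Y_b[v_Y[i],v_Y[j]]$, respectively $\mathbf X^r_b[v_Y[i],v_Y[j]]$; and replace $\mathrm q_b$ by the vector with entries $\pi[v_X[l],v_Y[l]]$. **Proposition.** Let $\{\mathbb X^s\}_{s=1}^S$ be finite templates, let $\lambda\in\Delta_{S-1}$ (that is, $\lambda_s\ge0$ and $\sum_s\lambda_s=1$), let $\mathbb Y$ be a finite network, and let $\mathbf X^1_b,\dots,\mathbf X^S_b$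 and $(\mathbf Y_b,\mathrm q_b)$ be any optimal blow-up of the templates with respect to $\mathbb Y$. Let $G_\lambda([\mathbb Y'])=\frac12\sum_{s=1}^S\lambda_s\,GW^2(\mathbb X^s,\mathbb Y')$. If the gradient $\nabla G_\lambda([\mathbb Y])$ exists, then $$\|\nabla G_\lambda([\mathbb Y])\|^2_{\mathrm{Tan}_{[\mathbb Y]}}=\lambda^T\mathcal A\lambda,\qquad \mathcal A_{sr}=\sum_{i,j}(\mathbf X^s_b-\mathbf Y_b)_{ij}\,(\mathbf X^r_b-\mathbf Y_b)_{ij}\,(\mathrm q_b)_i(\mathrm q_b)_j .$$ -/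

import Mathlib

open MeasureTheory Filter Topology

namespace GWSpace

noncomputable section

/-! ### Networks, couplings and the Gromov–Wasserstein distance -/

/-- A network `(X, ω, μ)`: a Polish space with a fully supported Borel probability measure and a
square-integrable weight function. (Every Polish space has a copy in `Type`.) -/
structure Network where
  carrier : Type
  [top : TopologicalSpace carrier]
  [polish : PolishSpace carrier]
  [meas : MeasurableSpace carrier]
  [borel : BorelSpace carrier]
  μ : Measure carrier
  [prob : IsProbabilityMeasure μ]
  [fullSupport : μ.IsOpenPosMeasure]
  ω : carrier × carrier → ℝ
  memLp : MemLp ω 2 (μ.prod μ)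

attribute [instance] Network.top Network.polish Network.meas Network.borel Network.prob
  Network.fullSupport

/-- `π ∈ Π(μ, ν)`. -/
def IsCoupling {α β : Type} [MeasurableSpace α] [MeasurableSpace β] (μ : Measure α)
    (ν : Measure β) (π : Measure (α × β)) : Prop :=
  π.map Prod.fst = μ ∧ π.map Prod.snd = ν

/-- The distortion `∬ |ω_X(x,x') - ω_Y(y,y')|² dπ(x,y) dπ(x',y')` of a plan. -/
def distortion (X Y : Network) (π : Measure (X.carrier × Y.carrier)) : ℝ :=
  ∫ z, |X.ω (z.1.1, z.2.1) - Y.ω (z.1.2, z.2.2)| ^ 2 ∂(π.prod π)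

/-- The Gromov–Wasserstein distance (with exponent `2`). -/
def GW (X Y : Network) : ℝ :=
  ⨅ π : {π : Measure (X.carrier × Y.carrier) // IsCoupling X.μ Y.μ π}, √(distortion X Y π.1)

/-- A common resolution of two networks: a Borel probability space `(Z, μ_Z)` with measure
preserving maps to both, along which the two weight functions pull back to the same function
almost everywhere. -/
structure CommonResolution (X Y : Network) where
  Z : Type
  [meas : MeasurableSpace Z]
  [borel : StandardBorelSpace Z]
  μ : Measure Z
  [prob : IsProbabilityMeasure μ]
  φ : Z → X.carrier
  ψ : Z → Y.carrier
  φ_preserving : MeasurePreserving φ μ X.μ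
  ψ_preserving : MeasurePreserving ψ μ Y.μ
  pullback_eq : ∀ᵐ z ∂(μ.prod μ), X.ω (φ z.1, φ z.2) = Y.ω (ψ z.1, ψ z.2)

attribute [instance] CommonResolution.meas CommonResolution.borel CommonResolution.prob

/-- Weak isomorphism of networks; `[Y]` is the class of `Y` for this relation. -/
def WeakIso (X Y : Network) : Prop := Nonempty (CommonResolution X Y)

/-! ### Tangent space, exponential map, directional derivatives, gradients -/

/-- An element of `⋃_{(Y', ω', μ') ∈ [Y]} L²(Y' × Y', μ' ⊗ μ')`. -/
structure TangentRep (Y : Network) where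
  base : Network
  mem_class : WeakIso base Y
  vec : base.carrier × base.carrier → ℝ
  memLp : MemLp vec 2 (base.μ.prod base.μ)

/-- `v ≃ v'`: some self-coupling of the bases matches both the weights and the vectors. -/
def TangentRep.Equiv {Y : Network} (v w : TangentRep Y) : Prop :=
  ∃ π : Measure (v.base.carrier × w.base.carrier), IsCoupling v.base.μ w.base.μ π ∧
    ∀ᵐ z ∂(π.prod π),
      v.base.ω (z.1.1, z.2.1) = w.base.ω (z.1.2, z.2.2) ∧
      v.vec (z.1.1, z.2.1) = w.vec (z.1.2, z.2.2)

/-- The tangent space `Tan_[Y]`. -/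
def Tan (Y : Network) : Type 1 := Quot (TangentRep.Equiv (Y := Y))

/-- `⟨φ^* v, ψ^* w⟩` in `L²(Z × Z, μ_Z ⊗ μ_Z)` for a common resolution `Z` of the two bases. -/
def pairing {Y : Network} (v w : TangentRep Y) (R : CommonResolution v.base w.base) : ℝ :=
  ∫ z, v.vec (R.φ z.1, R.φ z.2) * w.vec (R.ψ z.1, R.ψ z.2) ∂(R.μ.prod R.μ)

/-- `⟨ξ, η⟩_{Tan_[Y]} = c`: the inner product of the two classes is well defined, with value `c`;
that is, all representatives and all common resolutions give the value `c`. -/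
def HasInner {Y : Network} (ξ η : Tan Y) (c : ℝ) : Prop :=
  ∀ v w : TangentRep Y, Quot.mk _ v = ξ → Quot.mk _ w = η →
    ∀ R : CommonResolution v.base w.base, pairing v w R = c

/-- `‖ξ‖²_{Tan_[Y]} = c`. -/
def HasNormSq {Y : Network} (ξ : Tan Y) (c : ℝ) : Prop := HasInner ξ ξ c

/-- The diagonal common resolution of a network with itself. -/
def CommonResolution.diagonal (Y : Network) : CommonResolution Y Y where
  Z := Y.carrier
  μ := Y.μ
  φ := id
  ψ := id
  φ_preserving := MeasurePreserving.id _
  ψ_preserving := MeasurePreserving.id _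
  pullback_eq := Eventually.of_forall fun _ => rfl

/-- If `‖[v]‖²` has the value `c`, then `c` is the squared `L²`-norm of `v`. -/
theorem HasNormSq.eq_integral {Y : Network} {v : TangentRep Y} {c : ℝ}
    (h : HasNormSq (Quot.mk _ v) c) : c = ∫ z, v.vec z ^ 2 ∂(v.base.μ.prod v.base.μ) := by
  rw [← h v v rfl rfl (CommonResolution.diagonal v.base)]
  simp only [pairing, CommonResolution.diagonal, id_eq, Prod.mk.eta, sq]
  rfl

/-- The representative `(Y', ω' + t v, μ')` of `Exp_[Y]([t v])`, for `v ∈ L²(Y' × Y', μ' ⊗ μ')`. -/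
def expRep {Y : Network} (v : TangentRep Y) (t : ℝ) : Network where
  carrier := v.base.carrier
  μ := v.base.μ
  ω := fun y => v.base.ω y + t * v.vec y
  memLp := v.base.memLp.add (v.memLp.const_mul t)

/-- `D_ξ G([Y]) = d`, for a functional `G` on networks (evaluated on representatives). -/
def HasDirDeriv {Y : Network} (G : Network → ℝ) (ξ : Tan Y) (d : ℝ) : Prop :=
  ∀ v : TangentRep Y, Quot.mk _ v = ξ →
    Tendsto (fun t : ℝ => (G (expRep v t) - G v.base) / t) (𝓝[>] 0) (𝓝 d)

/-- `γ = ∇G([Y])`: all directional derivatives exist and `D_ξ G([Y]) = ⟨ξ, γ⟩` for all `ξ`. -/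
def IsGradient (G : Network → ℝ) (Y : Network) (γ : Tan Y) : Prop :=
  ∀ ξ : Tan Y, ∃ d : ℝ, HasDirDeriv G ξ d ∧ HasInner ξ γ d

/-! ### Finite networks -/

/-- A finite network `(𝐗, p)`: an `N × N` matrix and a positive probability vector. -/
structure FinNetwork where
  N : ℕ
  mat : Matrix (Fin N) (Fin N) ℝ
  p : Fin N → ℝ
  p_pos : ∀ i, 0 < p i
  p_sum : ∑ i, p i = 1

/-- The measure `∑ p_i δ_i`. -/
def vecMeasure {N : ℕ} (p : Fin N → ℝ) : Measure (Fin N) :=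
  ∑ i, ENNReal.ofReal (p i) • Measure.dirac i

theorem isProbabilityMeasure_vecMeasure {N : ℕ} (p : Fin N → ℝ) (h0 : ∀ i, 0 < p i)
    (h1 : ∑ i, p i = 1) : IsProbabilityMeasure (vecMeasure p) := by
  constructor
  simp only [vecMeasure, Measure.coe_finsetSum, Finset.sum_apply, Measure.smul_apply,
    measure_univ, smul_eq_mul, mul_one]
  rw [← ENNReal.ofReal_sum_of_nonneg fun i _ => (h0 i).le, h1, ENNReal.ofReal_one]

theorem isOpenPosMeasure_vecMeasure {N : ℕ} (p : Fin N → ℝ) (h0 : ∀ i, 0 < p i) :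
    (vecMeasure p).IsOpenPosMeasure := by
  constructor
  rintro U - ⟨i, hi⟩ h
  simp only [vecMeasure, Measure.coe_finsetSum, Finset.sum_apply, Measure.smul_apply,
    smul_eq_mul, Finset.sum_eq_zero_iff, Finset.mem_univ, true_implies] at h
  have := h i
  simp [hi, not_le.mpr (h0 i)] at this

/-- The network `([N], 𝐗, ∑ p_i δ_i)`. -/
def FinNetwork.toNetwork (X : FinNetwork) : Network :=
  haveI := isProbabilityMeasure_vecMeasure X.p X.p_pos X.p_sum
  haveI := isOpenPosMeasure_vecMeasure X.p X.p_pos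
  { carrier := Fin X.N
    μ := vecMeasure X.p
    ω := fun x => X.mat x.1 x.2
    memLp := MemLp.of_discrete }

/-! ### Optimal blow-up of several templates with respect to a fixed network -/

/-- Couplings of two vectors, as matrices. -/
def IsPlan {N M : ℕ} (p : Fin N → ℝ) (q : Fin M → ℝ) (π : Matrix (Fin N) (Fin M) ℝ) : Prop :=
  (∀ i j, 0 ≤ π i j) ∧ (∀ i, ∑ j, π i j = p i) ∧ (∀ j, ∑ i, π i j = q j)

/-- `∑_{i,j} ∑_{k,l} |𝐗_{ik} - 𝐘_{jl}|² π_{ij} π_{kl}`. -/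
def planCost {N M : ℕ} (X : Matrix (Fin N) (Fin N) ℝ) (Y : Matrix (Fin M) (Fin M) ℝ)
    (π : Matrix (Fin N) (Fin M) ℝ) : ℝ :=
  ∑ i, ∑ j, ∑ k, ∑ l, |X i k - Y j l| ^ 2 * π i j * π k l

/-- `π` is an optimal plan for `GW((𝐗, p), (𝐘, q))`. -/
def IsOptimalPlan {N M : ℕ} (X : Matrix (Fin N) (Fin N) ℝ) (p : Fin N → ℝ)
    (Y : Matrix (Fin M) (Fin M) ℝ) (q : Fin M → ℝ) (π : Matrix (Fin N) (Fin M) ℝ) : Prop :=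
  IsPlan p q π ∧ ∀ π' : Matrix (Fin N) (Fin M) ℝ, IsPlan p q π' → planCost X Y π ≤ planCost X Y π'

/-- The data held by the blow-up algorithm after `s` templates have been processed: the size
`M_b`, the blown-up network `(𝐘_b, q_b)` and the blown-up templates `𝐗_b^1, …, 𝐗_b^s`. -/
structure BlowUpData (s : ℕ) where
  size : ℕ
  Y : Matrix (Fin size) (Fin size) ℝ
  q : Fin size → ℝ
  X : Fin s → Matrix (Fin size) (Fin size) ℝ

/-- Before the first pass of the loop. -/
def BlowUpData.initial (Y : FinNetwork) : BlowUpData 0 where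
  size := Y.N
  Y := Y.mat
  q := Y.p
  X := fun r => r.elim0

/-- One pass of the loop, for the template `X`, the plan `π`, and an enumeration
`l ↦ (v_X[l], v_Y[l])` of the non-null entries of `π`. -/
def BlowUpData.next {s : ℕ} (B : BlowUpData s) (X : FinNetwork)
    (π : Matrix (Fin X.N) (Fin B.size) ℝ) {m : ℕ}
    (e : Fin m ≃ {x : Fin X.N × Fin B.size // π x.1 x.2 ≠ 0}) : BlowUpData (s + 1) where
  size := m
  Y := B.Y.submatrix (fun l => (e l).1.2) (fun l => (e l).1.2)
  q := fun l => π (e l).1.1 (e l).1.2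
  X := Fin.snoc (α := fun _ => Matrix (Fin m) (Fin m) ℝ)
    (fun r => (B.X r).submatrix (fun l => (e l).1.2) (fun l => (e l).1.2))
    (X.mat.submatrix (fun l => (e l).1.1) (fun l => (e l).1.1))

/-- `B` is a possible output of the optimal blow-up of the templates `T` with respect to `Y`
(every choice of optimal plans and of enumerations of their non-null entries is allowed). -/
inductive IsOptimalBlowUp (Y : FinNetwork) :
    (s : ℕ) → (Fin s → FinNetwork) → BlowUpData s → Prop
  | initial (T : Fin 0 → FinNetwork) : IsOptimalBlowUp Y 0 T (BlowUpData.initial Y)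
  | next {s : ℕ} (T : Fin (s + 1) → FinNetwork) (B : BlowUpData s)
      (hB : IsOptimalBlowUp Y s (fun r => T r.castSucc) B)
      (π : Matrix (Fin (T (Fin.last s)).N) (Fin B.size) ℝ)
      (hπ : IsOptimalPlan (T (Fin.last s)).mat (T (Fin.last s)).p B.Y B.q π)
      {m : ℕ} (e : Fin m ≃ {x : Fin (T (Fin.last s)).N × Fin B.size // π x.1 x.2 ≠ 0}) :
      IsOptimalBlowUp Y (s + 1) T (B.next (T (Fin.last s)) π e)

/-! ### The barycenter functional and the Gram matrix -/

/-- `G_λ([Y]) = ½ ∑_s λ_s GW²(X^s, Y)`. -/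
def baryFunctional {S : ℕ} (T : Fin S → FinNetwork) (lam : Fin S → ℝ) (Y : Network) : ℝ :=
  1 / 2 * ∑ s, lam s * GW (T s).toNetwork Y ^ 2

/-- `tr_q(Aᵀ B) = ∑_{i,j} A_{ij} B_{ij} q_i q_j`. -/
def weightedTrace {M : ℕ} (q : Fin M → ℝ) (A B : Matrix (Fin M) (Fin M) ℝ) : ℝ :=
  ∑ i, ∑ j, A i j * B i j * q i * q j

/-- `𝒜_{sr} = tr_{q_b}((𝐗_b^s - 𝐘_b)ᵀ (𝐗_b^r - 𝐘_b))`. -/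
def BlowUpData.gram {S : ℕ} (B : BlowUpData S) : Matrix (Fin S) (Fin S) ℝ :=
  Matrix.of fun s r => weightedTrace B.q (B.X s - B.Y) (B.X r - B.Y)

end

end GWSpace

namespace GWSpace

/-! ### Gluing of measures, couplings, and bounds on `GW`. -/

open ProbabilityTheory

/-! The blow-up produces one network `W = (𝐘_b, q_b)` in the class of `Y`, together with measure
preserving maps `f s` from `W` to the templates such that the plan carried by the graph of `f s`
realizes `GW` for every `s` at once (`IsOptimalBlowUp.spec`). The candidate for the gradient is the
vector `w = ∑ λ_s (𝐘_b - 𝐗_b^s)` over `W`; expanding the square gives `‖w‖² = λᵀ𝒜λ`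
(`BlowUpData.pairing_tangent`).

Neither uniqueness of optimal plans nor a formula for the directional derivatives is needed. Along a
ray `ω + t u`, the optimal plan at `t = 0` stays admissible, and its distortion is a quadratic
polynomial in `t` (`GW_expRep_sq_le`). Since the weights `λ_s` are nonnegative, this bounds the
functional from above with equality at `t = 0`, so every directional derivative satisfies `D_u G ≤
⟨u, w⟩`.

If a gradient `γ` exists, then `D_u G = ⟨u, γ⟩` is odd in `u`; the bound for `u` and `-u` forces
`⟨u, γ⟩ = ⟨u, w⟩` for all `u`. Taking `u = w` and `u = γ` yields `‖w‖² = ⟨w, γ⟩ = ⟨γ, w⟩ = ‖γ‖²`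
(`IsGradient.hasNormSq_of_le`). -/

/-- Gluing of a probability measure on `Z` and a measure on `A × C` along a map `Z → A`. -/
theorem exists_glue {Z A C : Type} [MeasurableSpace Z] [MeasurableSpace A] [MeasurableSpace C]
    [StandardBorelSpace C] [Nonempty C] (μ : Measure Z) [IsProbabilityMeasure μ] {φ : Z → A}
    (hφ : Measurable φ) (ν : Measure (A × C)) [IsFiniteMeasure ν]
    (h : ν.map Prod.fst = μ.map φ) :
    ∃ ρ : Measure (Z × C), ρ.map Prod.fst = μ ∧ ρ.map (Prod.map φ id) = ν := by
  -- Given `z`, the `C`-coordinate is drawn from the conditional law of `ν` at `φ z`.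
  refine ⟨μ ⊗ₘ (ν.condKernel.comap φ hφ), Measure.fst_compProd μ _, ?_⟩
  ext s hs
  rw [Measure.map_apply (hφ.prodMap measurable_id) hs,
    Measure.compProd_apply ((hφ.prodMap measurable_id) hs)]
  conv_rhs => rw [← ν.disintegrate ν.condKernel, Measure.compProd_apply hs]
  rw [Measure.fst, h, lintegral_map (Kernel.measurable_kernel_prodMk_left hs) hφ]
  rfl

theorem isProbabilityMeasure_of_map {α β : Type} [MeasurableSpace α] [MeasurableSpace β]
    {ρ : Measure α} {μ : Measure β} [IsProbabilityMeasure μ] {f : α → β} (hf : Measurable f)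
    (h : ρ.map f = μ) : IsProbabilityMeasure ρ := by
  constructor
  rw [← Set.preimage_univ (f := f), ← Measure.map_apply hf MeasurableSet.univ, h, measure_univ]

theorem integral_comp_preserving {α β : Type} [MeasurableSpace α] [MeasurableSpace β]
    {μ : Measure α} {ν : Measure β} {f : α → β} (hf : MeasurePreserving f μ ν) {g : β → ℝ}
    (hg : AEStronglyMeasurable g ν) : ∫ x, g (f x) ∂μ = ∫ y, g y ∂ν := by
  rw [← hf.map_eq] at hg ⊢
  exact (integral_map hf.measurable.aemeasurable hg).symm

theorem IsCoupling.of_preserving {X Y : Network} {Z : Type} [MeasurableSpace Z] {μ : Measure Z}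
    {α : Z → X.carrier} {β : Z → Y.carrier} (hα : MeasurePreserving α μ X.μ)
    (hβ : MeasurePreserving β μ Y.μ) : IsCoupling X.μ Y.μ (μ.map fun z => (α z, β z)) := by
  have h := hα.measurable.prodMk hβ.measurable
  constructor
  · rw [Measure.map_map measurable_fst h]; exact hα.map_eq
  · rw [Measure.map_map measurable_snd h]; exact hβ.map_eq

theorem IsCoupling.isProbabilityMeasure {X Y : Network} {π : Measure (X.carrier × Y.carrier)}
    (h : IsCoupling X.μ Y.μ π) : IsProbabilityMeasure π :=
  isProbabilityMeasure_of_map measurable_fst h.1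

theorem IsCoupling.aestronglyMeasurable {X Y : Network} {π : Measure (X.carrier × Y.carrier)}
    (h : IsCoupling X.μ Y.μ π) :
    AEStronglyMeasurable (fun z : (X.carrier × Y.carrier) × (X.carrier × Y.carrier) =>
      |X.ω (z.1.1, z.2.1) - Y.ω (z.1.2, z.2.2)| ^ 2) (π.prod π) := by
  have := h.isProbabilityMeasure
  have h1 : MeasurePreserving Prod.fst π X.μ := ⟨measurable_fst, h.1⟩
  have h2 : MeasurePreserving Prod.snd π Y.μ := ⟨measurable_snd, h.2⟩
  have a := X.memLp.1.comp_measurePreserving (h1.prod h1)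
  have b := Y.memLp.1.comp_measurePreserving (h2.prod h2)
  exact ((a.sub b).norm).pow 2

/-- The distortion of a plan given by two maps from a probability space. -/
theorem distortion_map {X Y : Network} {Z : Type} [MeasurableSpace Z] {μ : Measure Z}
    [IsProbabilityMeasure μ] {α : Z → X.carrier} {β : Z → Y.carrier}
    (hα : MeasurePreserving α μ X.μ) (hβ : MeasurePreserving β μ Y.μ) :
    distortion X Y (μ.map fun z => (α z, β z)) =
      ∫ z, |X.ω (α z.1, α z.2) - Y.ω (β z.1, β z.2)| ^ 2 ∂(μ.prod μ) := by
  have hc := IsCoupling.of_preserving hα hβ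
  have := hc.isProbabilityMeasure
  have hm : MeasurePreserving (fun z => (α z, β z)) μ (μ.map fun z => (α z, β z)) :=
    ⟨hα.measurable.prodMk hβ.measurable, rfl⟩
  exact (integral_comp_preserving (hm.prod hm) hc.aestronglyMeasurable).symm

theorem distortion_nonneg (X Y : Network) (π : Measure (X.carrier × Y.carrier)) :
    0 ≤ distortion X Y π := integral_nonneg fun _ => by positivity

theorem GW_nonneg (X Y : Network) : 0 ≤ GW X Y := Real.iInf_nonneg fun _ => Real.sqrt_nonneg _

theorem GW_sq_le {X Y : Network} {π : Measure (X.carrier × Y.carrier)}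
    (h : IsCoupling X.μ Y.μ π) : GW X Y ^ 2 ≤ distortion X Y π := by
  rw [← Real.sq_sqrt (distortion_nonneg X Y π)]
  refine pow_le_pow_left₀ (GW_nonneg X Y) ?_ 2
  exact ciInf_le (f := fun π : {π : Measure (X.carrier × Y.carrier) // IsCoupling X.μ Y.μ π} =>
    √(distortion X Y π.1)) ⟨0, by rintro _ ⟨π, rfl⟩; exact Real.sqrt_nonneg _⟩ ⟨π, h⟩

theorem isCoupling_prod (X Y : Network) : IsCoupling X.μ Y.μ (X.μ.prod Y.μ) :=
  ⟨Measure.fst_prod, Measure.snd_prod⟩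

theorem le_GW_sq {X Y : Network} {c : ℝ} (hc : 0 ≤ c)
    (h : ∀ π, IsCoupling X.μ Y.μ π → c ≤ distortion X Y π) : c ≤ GW X Y ^ 2 := by
  -- The product coupling excludes an empty index set, for which the real infimum would be `0`.
  have : Nonempty {π : Measure (X.carrier × Y.carrier) // IsCoupling X.μ Y.μ π} :=
    ⟨⟨_, isCoupling_prod X Y⟩⟩
  rw [← Real.sq_sqrt hc]
  exact pow_le_pow_left₀ (Real.sqrt_nonneg c)
    (le_ciInf fun π : {π // IsCoupling X.μ Y.μ π} =>
      Real.sqrt_le_sqrt (h π.1 π.2)) 2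

theorem GW_sq_eq {X Y : Network} {π : Measure (X.carrier × Y.carrier)}
    (hπ : IsCoupling X.μ Y.μ π)
    (h : ∀ π', IsCoupling X.μ Y.μ π' → distortion X Y π ≤ distortion X Y π') :
    GW X Y ^ 2 = distortion X Y π :=
  (GW_sq_le hπ).antisymm (le_GW_sq (distortion_nonneg X Y π) h)

/-! ### Operations on common resolutions, weak invariance -/

/-- The common resolution with the two networks exchanged. -/
def CommonResolution.symm {X Y : Network} (R : CommonResolution X Y) : CommonResolution Y X where
  Z := R.Z
  μ := R.μ
  φ := R.ψ
  ψ := R.φ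
  φ_preserving := R.ψ_preserving
  ψ_preserving := R.φ_preserving
  pullback_eq := R.pullback_eq.mono fun _ h => h.symm

theorem WeakIso.symm {X Y : Network} (h : WeakIso X Y) : WeakIso Y X := h.map (·.symm)

/-- The two resolutions are glued over the middle network: `R.μ` is glued along `R.ψ` to the law of
`(R'.φ z, z)`, so that the two maps to `Y` agree almost surely on the glued space. -/
theorem WeakIso.trans {X Y W : Network} (h : WeakIso X Y) (h' : WeakIso Y W) : WeakIso X W := by
  obtain ⟨R⟩ := h
  obtain ⟨R'⟩ := h'
  have : Nonempty R'.Z := R'.μ.nonempty_of_neZero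
  have hm : Measurable fun z : R'.Z => (R'.φ z, z) :=
    R'.φ_preserving.measurable.prodMk measurable_id
  have hsnd : (R'.μ.map fun z => (R'.φ z, z)).map Prod.snd = R'.μ := by
    rw [Measure.map_map measurable_snd hm]; exact Measure.map_id
  obtain ⟨ρ, h1, h2⟩ := exists_glue R.μ R.ψ_preserving.measurable
    (R'.μ.map fun z => (R'.φ z, z)) (by
      rw [Measure.map_map measurable_fst hm, R.ψ_preserving.map_eq]
      exact R'.φ_preserving.map_eq)
  have hρ1 : MeasurePreserving Prod.fst ρ R.μ := ⟨measurable_fst, h1⟩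
  have hρ : MeasurePreserving (Prod.map R.ψ id) ρ (R'.μ.map fun z => (R'.φ z, z)) :=
    ⟨R.ψ_preserving.measurable.prodMap measurable_id, h2⟩
  have hρ2 : MeasurePreserving Prod.snd ρ R'.μ := (⟨measurable_snd, hsnd⟩ :
    MeasurePreserving Prod.snd (R'.μ.map fun z => (R'.φ z, z)) R'.μ).comp hρ
  have := isProbabilityMeasure_of_map measurable_fst h1
  -- The graph of `R'.φ` carries the measure glued in, and the property pulls back along `hρ`.
  have hmid : ∀ᵐ z ∂ρ, R.ψ z.1 = R'.φ z.2 := by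
    have : ∀ᵐ y ∂(R'.μ.map fun z => (R'.φ z, z)), y.1 = R'.φ y.2 := by
      have hs : MeasurableSet {y : Y.carrier × R'.Z | y.1 = R'.φ y.2} :=
        measurableSet_eq_fun measurable_fst (R'.φ_preserving.measurable.comp measurable_snd)
      rw [ae_map_iff hm.aemeasurable hs]
      exact Eventually.of_forall fun _ => rfl
    exact hρ.quasiMeasurePreserving.ae this
  refine ⟨{
    Z := R.Z × R'.Z
    μ := ρ
    φ := fun z => R.φ z.1
    ψ := fun z => R'.ψ z.2
    φ_preserving := R.φ_preserving.comp hρ1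
    ψ_preserving := R'.ψ_preserving.comp hρ2
    pullback_eq := ?_ }⟩
  filter_upwards [(hρ1.prod hρ1).quasiMeasurePreserving.ae R.pullback_eq,
    (hρ2.prod hρ2).quasiMeasurePreserving.ae R'.pullback_eq,
    Measure.quasiMeasurePreserving_fst.ae hmid, Measure.quasiMeasurePreserving_snd.ae hmid]
    with z a b c d
  simp only [Prod.map_fst, Prod.map_snd] at a b
  rw [a, c, d, b]

/-- Couplings transfer along weak isomorphisms without change of distortion. -/
theorem WeakIso.exists_coupling {X V W : Network} (h : WeakIso V W)
    {π : Measure (X.carrier × V.carrier)} (hπ : IsCoupling X.μ V.μ π) :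
    ∃ π' : Measure (X.carrier × W.carrier), IsCoupling X.μ W.μ π' ∧
      distortion X W π' = distortion X V π := by
  obtain ⟨R⟩ := h
  have := hπ.isProbabilityMeasure
  have : Nonempty X.carrier := X.μ.nonempty_of_neZero
  -- The coordinate glued along must come first in `exists_glue`, hence the exchange of `X` and `V`.
  have hsw : MeasurePreserving Prod.swap (π.map Prod.swap) π :=
    ⟨measurable_swap, by rw [Measure.map_map measurable_swap measurable_swap]; simp⟩
  have hfst : (π.map Prod.swap).map Prod.fst = V.μ := by
    rw [Measure.map_map measurable_fst measurable_swap]; exact hπ.2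
  obtain ⟨ρ, h1, h2⟩ := exists_glue R.μ R.φ_preserving.measurable (π.map Prod.swap)
    (by rw [hfst, R.φ_preserving.map_eq])
  have := isProbabilityMeasure_of_map measurable_fst h1
  have hρ1 : MeasurePreserving Prod.fst ρ R.μ := ⟨measurable_fst, h1⟩
  have hρ : MeasurePreserving (Prod.map R.φ id) ρ (π.map Prod.swap) :=
    ⟨R.φ_preserving.measurable.prodMap measurable_id, h2⟩
  have hρπ : MeasurePreserving (fun z : R.Z × X.carrier => (z.2, R.φ z.1)) ρ π := hsw.comp hρ
  have hX : MeasurePreserving (fun z : R.Z × X.carrier => z.2) ρ X.μ :=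
    (⟨measurable_fst, hπ.1⟩ : MeasurePreserving Prod.fst π X.μ).comp hρπ
  have hV := R.φ_preserving.comp hρ1
  have hW := R.ψ_preserving.comp hρ1
  refine ⟨_, IsCoupling.of_preserving hX hW, ?_⟩
  conv_rhs => rw [← hρπ.map_eq]
  rw [distortion_map hX hW]
  refine Eq.trans ?_ (distortion_map hX hV).symm
  refine integral_congr_ae ?_
  filter_upwards [(hρ1.prod hρ1).quasiMeasurePreserving.ae R.pullback_eq] with z hz
  simp only [Prod.map_fst, Prod.map_snd] at hz
  simp only [Function.comp_apply, hz]

/-- Every coupling with one network has a counterpart of the same distortion with the other. This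
lets `GW` be evaluated at the blown-up network, or at the base of any tangent vector, instead of at
`Y`. -/
theorem WeakIso.GW_sq_eq {X V W : Network} (h : WeakIso V W) : GW X V ^ 2 = GW X W ^ 2 := by
  have key : ∀ {V W : Network}, WeakIso V W → GW X V ^ 2 ≤ GW X W ^ 2 := by
    intro V W h
    refine le_GW_sq (sq_nonneg _) fun π hπ => ?_
    obtain ⟨π', h', e⟩ := h.symm.exists_coupling hπ
    exact (GW_sq_le h').trans e.le
  exact (key h).antisymm (key h.symm)

/-! ### Finite networks -/

theorem lintegral_vecMeasure {N : ℕ} (p : Fin N → ℝ) (g : Fin N → ENNReal) :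
    ∫⁻ i, g i ∂(vecMeasure p) = ∑ i, ENNReal.ofReal (p i) * g i := by
  simp [vecMeasure, lintegral_finsetSum_measure, lintegral_smul_measure]

theorem vecMeasure_singleton {N : ℕ} (p : Fin N → ℝ) (i : Fin N) :
    vecMeasure p {i} = ENNReal.ofReal (p i) := by
  rw [← lintegral_indicator_one (measurableSet_singleton i), lintegral_vecMeasure]
  simp [Set.indicator_apply]

theorem measureReal_vecMeasure_singleton {N : ℕ} {p : Fin N → ℝ} (h0 : ∀ i, 0 < p i) (i : Fin N) :
    (vecMeasure p).real {i} = p i := by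
  rw [Measure.real, vecMeasure_singleton, ENNReal.toReal_ofReal (h0 i).le]

theorem integral_prod_self_fintype {α : Type} [Fintype α] [MeasurableSpace α]
    [DiscreteMeasurableSpace α] (μ : Measure α) [IsFiniteMeasure μ] (g : α × α → ℝ) :
    ∫ z, g z ∂(μ.prod μ) = ∑ a, ∑ b, μ.real {a} * μ.real {b} * g (a, b) := by
  rw [integral_fintype (Integrable.of_finite), Fintype.sum_prod_type]
  simp [← Set.singleton_prod_singleton, measureReal_prod_prod]

theorem measurePreserving_vecMeasure {N M : ℕ} {q : Fin M → ℝ} {p : Fin N → ℝ}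
    (h0 : ∀ i, 0 < q i) {f : Fin M → Fin N} (h : ∀ j, ∑ i with f i = j, q i = p j) :
    MeasurePreserving f (vecMeasure q) (vecMeasure p) := by
  refine ⟨measurable_of_finite f, Measure.ext_of_singleton fun j => ?_⟩
  rw [Measure.map_apply (measurable_of_finite f) (measurableSet_singleton j),
    vecMeasure_singleton, ← h j, ENNReal.ofReal_sum_of_nonneg fun i _ => (h0 i).le,
    ← lintegral_indicator_one (measurable_of_finite f (measurableSet_singleton j)),
    lintegral_vecMeasure, Finset.sum_filter]
  refine Finset.sum_congr rfl fun i _ => ?_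
  by_cases h : f i = j <;> simp [h]

theorem weightedTrace_eq_integral {N : ℕ} {q : Fin N → ℝ} (h0 : ∀ i, 0 < q i)
    (h1 : ∑ i, q i = 1) (A B : Matrix (Fin N) (Fin N) ℝ) :
    weightedTrace q A B =
      ∫ z, A z.1 z.2 * B z.1 z.2 ∂((vecMeasure q).prod (vecMeasure q)) := by
  have := isProbabilityMeasure_vecMeasure q h0 h1
  rw [integral_prod_self_fintype]
  simp only [measureReal_vecMeasure_singleton h0, weightedTrace]
  exact Finset.sum_congr rfl fun i _ => Finset.sum_congr rfl fun j _ => by ring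

/-- A change of variables along `f`: refining the blow-up for a later template leaves the costs
already realized unchanged. -/
theorem weightedTrace_submatrix {N M : ℕ} {q : Fin M → ℝ} {p : Fin N → ℝ} (hp : ∀ i, 0 < p i)
    (hp1 : ∑ i, p i = 1) (hq : ∀ i, 0 < q i) (hq1 : ∑ i, q i = 1) {f : Fin M → Fin N}
    (hf : MeasurePreserving f (vecMeasure q) (vecMeasure p)) (A B : Matrix (Fin N) (Fin N) ℝ) :
    weightedTrace q (A.submatrix f f) (B.submatrix f f) = weightedTrace p A B := by
  have := isProbabilityMeasure_vecMeasure q hq hq1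
  have := isProbabilityMeasure_vecMeasure p hp hp1
  rw [weightedTrace_eq_integral hq hq1, weightedTrace_eq_integral hp hp1,
    ← integral_comp_preserving (hf.prod hf) (by measurability)]
  rfl

/-- The distortion of a coupling of finite networks is the cost of the matrix of its masses. -/
theorem distortion_eq_planCost (X Y : FinNetwork)
    (π : Measure (Fin X.N × Fin Y.N)) [IsFiniteMeasure π] :
    distortion X.toNetwork Y.toNetwork π =
      planCost X.mat Y.mat (Matrix.of fun i j => π.real {(i, j)}) := by
  refine (integral_prod_self_fintype (α := Fin X.N × Fin Y.N) π fun z =>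
    |X.mat z.1.1 z.2.1 - Y.mat z.1.2 z.2.2| ^ 2).trans ?_
  simp only [Fintype.sum_prod_type, planCost, Matrix.of_apply]
  exact Finset.sum_congr rfl fun i _ => Finset.sum_congr rfl fun j _ =>
    Finset.sum_congr rfl fun k _ => Finset.sum_congr rfl fun l _ => by ring

theorem IsCoupling.isPlan {X Y : FinNetwork} {π : Measure (Fin X.N × Fin Y.N)}
    [IsFiniteMeasure π] (h : IsCoupling X.toNetwork.μ Y.toNetwork.μ π) :
    IsPlan X.p Y.p (Matrix.of fun i j => π.real {(i, j)}) := by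
  refine ⟨fun i j => measureReal_nonneg, fun i => ?_, fun j => ?_⟩
  · have h1 : π.map Prod.fst = vecMeasure X.p := h.1
    rw [← measureReal_vecMeasure_singleton X.p_pos i, ← h1,
      map_measureReal_apply measurable_fst (measurableSet_singleton i)]
    simp only [Matrix.of_apply]
    rw [← measureReal_biUnion_finset (f := fun j => {(i, j)})]
    · congr 1; ext ⟨a, b⟩; simp [eq_comm]
    · intro a _ b _ hab; simpa using hab
    · exact fun _ _ => measurableSet_singleton _
  · have h1 : π.map Prod.snd = vecMeasure Y.p := h.2
    rw [← measureReal_vecMeasure_singleton Y.p_pos j, ← h1,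
      map_measureReal_apply measurable_snd (measurableSet_singleton j)]
    simp only [Matrix.of_apply]
    rw [← measureReal_biUnion_finset (f := fun i => {(i, j)})]
    · congr 1; ext ⟨a, b⟩; simp [eq_comm]
    · intro a _ b _ hab; simpa using hab
    · exact fun _ _ => measurableSet_singleton _


/-! ### The blow-up algorithm -/

section Next

variable {s : ℕ} (B : BlowUpData s) (X : FinNetwork) {π : Matrix (Fin X.N) (Fin B.size) ℝ}
  {m : ℕ} (e : Fin m ≃ {x : Fin X.N × Fin B.size // π x.1 x.2 ≠ 0})

/-- The factor `π` in the summand kills the entries that the enumeration leaves out. -/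
theorem sum_enum (g : Fin X.N × Fin B.size → ℝ) :
    ∑ l, g (e l).1 * π (e l).1.1 (e l).1.2 = ∑ i, ∑ j, g (i, j) * π i j := by
  classical
  rw [e.sum_comp fun x => g x.1 * π x.1.1 x.1.2,
    ← Finset.sum_subtype (Finset.univ.filter fun x : Fin X.N × Fin B.size => π x.1 x.2 ≠ 0)
      (by simp) (fun x => g x * π x.1 x.2), ← Fintype.sum_prod_type'
    (f := fun i j => g (i, j) * π i j)]
  refine Finset.sum_filter_of_ne fun x _ hx h => ?_
  simp [h] at hx

theorem sum_sum_enum (g : Fin X.N × Fin B.size → Fin X.N × Fin B.size → ℝ) :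
    ∑ l, ∑ l', g (e l).1 (e l').1 * π (e l).1.1 (e l).1.2 * π (e l').1.1 (e l').1.2 =
      ∑ i, ∑ j, ∑ k, ∑ n, g (i, j) (k, n) * π i j * π k n := by
  have h : ∀ x : Fin X.N × Fin B.size,
      ∑ l', g x (e l').1 * π x.1 x.2 * π (e l').1.1 (e l').1.2 =
        (∑ k, ∑ n, g x (k, n) * π k n) * π x.1 x.2 := by
    intro x
    rw [sum_enum B X e fun y => g x y * π x.1 x.2]
    simp only [Finset.sum_mul]
    exact Finset.sum_congr rfl fun _ _ => Finset.sum_congr rfl fun _ _ => by ring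
  simp only [h]
  rw [sum_enum B X e fun x => ∑ k, ∑ n, g x (k, n) * π k n]
  simp only [Finset.sum_mul]
  exact Finset.sum_congr rfl fun _ _ => Finset.sum_congr rfl fun _ _ =>
    Finset.sum_congr rfl fun _ _ => Finset.sum_congr rfl fun _ _ => by ring

theorem next_X_last : (B.next X π e).X (Fin.last s) =
    X.mat.submatrix (fun l => (e l).1.1) (fun l => (e l).1.1) := by
  simp only [BlowUpData.next, Fin.snoc_last]

theorem next_X_castSucc (r : Fin s) : (B.next X π e).X r.castSucc =
    (B.X r).submatrix (fun l => (e l).1.2) (fun l => (e l).1.2) := by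
  simp only [BlowUpData.next, Fin.snoc_castSucc]

theorem next_q_pos (hπ : IsPlan X.p B.q π) (l : Fin m) : 0 < π (e l).1.1 (e l).1.2 :=
  lt_of_le_of_ne (hπ.1 _ _) (e l).2.symm

theorem next_q_sum (hπ : IsPlan X.p B.q π) : ∑ l, π (e l).1.1 (e l).1.2 = 1 := by
  have := sum_enum B X e fun _ => 1
  simp only [one_mul, hπ.2.1, X.p_sum] at this
  exact this

/-- The mass of a fibre is a row sum of the plan, the null entries contributing nothing. -/
theorem next_fst_preserving (hπ : IsPlan X.p B.q π) :
    MeasurePreserving (fun l => (e l).1.1) (vecMeasure fun l => π (e l).1.1 (e l).1.2) (vecMeasure X.p) := by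
  refine measurePreserving_vecMeasure (next_q_pos B X e hπ) fun j => ?_
  have := sum_enum B X e fun x => if x.1 = j then 1 else 0
  simp only [ite_mul, one_mul, zero_mul, Finset.sum_ite_irrel, Finset.sum_const_zero,
    Finset.sum_ite_eq', Finset.mem_univ, if_true, hπ.2.1] at this
  rw [Finset.sum_filter]
  exact this

theorem next_snd_preserving (hπ : IsPlan X.p B.q π) :
    MeasurePreserving (fun l => (e l).1.2) (vecMeasure fun l => π (e l).1.1 (e l).1.2) (vecMeasure B.q) := by
  refine measurePreserving_vecMeasure (next_q_pos B X e hπ) fun j => ?_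
  have := sum_enum B X e fun x => if x.2 = j then 1 else 0
  simp only [ite_mul, one_mul, zero_mul, Finset.sum_ite_eq', Finset.mem_univ, if_true,
    hπ.2.2] at this
  rw [Finset.sum_filter]
  exact this

/-- After the blow-up the plan is diagonal, so its cost becomes a squared `L²` distance of two
matrices of the same size. -/
theorem weightedTrace_next :
    weightedTrace (fun l => π (e l).1.1 (e l).1.2)
      (X.mat.submatrix (fun l => (e l).1.1) (fun l => (e l).1.1) - B.Y.submatrix (fun l => (e l).1.2) (fun l => (e l).1.2))
      (X.mat.submatrix (fun l => (e l).1.1) (fun l => (e l).1.1) - B.Y.submatrix (fun l => (e l).1.2) (fun l => (e l).1.2)) =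
      planCost X.mat B.Y π := by
  rw [planCost, ← sum_sum_enum B X e fun x y => |X.mat x.1 y.1 - B.Y x.2 y.2| ^ 2]
  refine Finset.sum_congr rfl fun l _ => Finset.sum_congr rfl fun l' _ => ?_
  rw [sq_abs, sq]
  rfl

end Next

/-- The blown-up network `(𝐘_b, q_b)`. -/
def BlowUpData.toFinNetwork {s : ℕ} (B : BlowUpData s) (h0 : ∀ i, 0 < B.q i)
    (h1 : ∑ i, B.q i = 1) : FinNetwork where
  N := B.size
  mat := B.Y
  p := B.q
  p_pos := h0
  p_sum := h1

/-- The Gromov–Wasserstein distance of finite networks is attained at an optimal plan. -/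
theorem IsOptimalPlan.GW_sq_eq {X Y : FinNetwork} {π : Matrix (Fin X.N) (Fin Y.N) ℝ}
    (hπ : IsOptimalPlan X.mat X.p Y.mat Y.p π) {Z : Type} [MeasurableSpace Z] {μ : Measure Z}
    [IsProbabilityMeasure μ] {α : Z → Fin X.N} {β : Z → Fin Y.N}
    (hα : MeasurePreserving α μ (vecMeasure X.p)) (hβ : MeasurePreserving β μ (vecMeasure Y.p))
    (h : ∫ z, |X.mat (α z.1) (α z.2) - Y.mat (β z.1) (β z.2)| ^ 2 ∂(μ.prod μ) =
      planCost X.mat Y.mat π) :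
    GW X.toNetwork Y.toNetwork ^ 2 = planCost X.mat Y.mat π := by
  have hd := distortion_map (X := X.toNetwork) (Y := Y.toNetwork) (μ := μ) hα hβ
  rw [← h]
  refine Eq.trans (GWSpace.GW_sq_eq (IsCoupling.of_preserving hα hβ) fun (π' : Measure (Fin X.N × Fin Y.N)) h' => ?_) hd
  have : IsFiniteMeasure π' := 
    ⟨h'.isProbabilityMeasure.measure_univ.trans_lt ENNReal.one_lt_top⟩
  rw [hd]
  -- The masses of a competing coupling form a plan, to which the optimality of `π` applies.
  refine h.le.trans ((hπ.2 _ (IsCoupling.isPlan h')).trans ?_)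
  exact (distortion_eq_planCost X Y π').ge

/-- The properties of the output of the optimal blow-up: the blown-up network is weakly isomorphic
to `Y`, and comes with maps to the templates that realize the Gromov–Wasserstein distances. -/
theorem IsOptimalBlowUp.spec {Y : FinNetwork} {S : ℕ} {T : Fin S → FinNetwork}
    {B : BlowUpData S} (hB : IsOptimalBlowUp Y S T B) :
    ∃ (h0 : ∀ i, 0 < B.q i) (h1 : ∑ i, B.q i = 1),
      WeakIso (B.toFinNetwork h0 h1).toNetwork Y.toNetwork ∧
      ∀ r, ∃ f : Fin B.size → Fin (T r).N, B.X r = (T r).mat.submatrix f f ∧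
        MeasurePreserving f (vecMeasure B.q) (vecMeasure (T r).p) ∧
        GW (T r).toNetwork Y.toNetwork ^ 2 = weightedTrace B.q (B.X r - B.Y) (B.X r - B.Y) := by
  induction hB with
  | initial T =>
    exact ⟨Y.p_pos, Y.p_sum, ⟨CommonResolution.diagonal _⟩, fun r => r.elim0⟩
  | @next s T B hB π hπ m e ih =>
    obtain ⟨h0, h1, hw, hr⟩ := ih
    have k0 : ∀ l, 0 < (B.next (T (Fin.last s)) π e).q l := next_q_pos B (T (Fin.last s)) e hπ.1
    have k1 : ∑ l, (B.next (T (Fin.last s)) π e).q l = 1 := next_q_sum B (T (Fin.last s)) e hπ.1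
    have hf : MeasurePreserving (fun l => (e l).1.1) (vecMeasure (B.next (T (Fin.last s)) π e).q)
      (vecMeasure (T (Fin.last s)).p) := next_fst_preserving B (T (Fin.last s)) e hπ.1
    have hg : MeasurePreserving (fun l => (e l).1.2) (vecMeasure (B.next (T (Fin.last s)) π e).q)
      (vecMeasure B.q) := next_snd_preserving B (T (Fin.last s)) e hπ.1
    have hp : IsProbabilityMeasure (vecMeasure fun l => π (e l).1.1 (e l).1.2) :=
      isProbabilityMeasure_vecMeasure _ k0 k1
    -- The new blow-up resolves the old one through `v_Y`, since its matrix is by construction the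
    -- pullback of `B.Y`.
    have hwn : WeakIso ((B.next (T (Fin.last s)) π e).toFinNetwork k0 k1).toNetwork
        (B.toFinNetwork h0 h1).toNetwork := ⟨{
      Z := Fin m
      μ := vecMeasure fun l => π (e l).1.1 (e l).1.2
      prob := hp
      φ := id
      ψ := fun l => (e l).1.2
      φ_preserving := MeasurePreserving.id _
      ψ_preserving := hg
      pullback_eq := Eventually.of_forall fun _ => rfl }⟩
    refine ⟨k0, k1, hwn.trans hw, fun r => ?_⟩
    refine Fin.lastCases ?_ (fun r => ?_) r
    · refine ⟨fun l => (e l).1.1, next_X_last B _ e, hf, ?_⟩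
      have hlast : (B.next (T (Fin.last s)) π e).X (Fin.last s) =
        (T (Fin.last s)).mat.submatrix (fun l => (e l).1.1) (fun l => (e l).1.1) :=
        next_X_last B _ e
      have htr := weightedTrace_next B (T (Fin.last s)) e
      -- The plan `π` is optimal against the previous blow-up, not `Y`; weak invariance bridges the
      -- two.
      rw [hlast, ← hw.GW_sq_eq]
      refine Eq.trans ?_ htr.symm
      refine IsOptimalPlan.GW_sq_eq (μ := vecMeasure fun l => π (e l).1.1 (e l).1.2) (Y := B.toFinNetwork h0 h1) hπ hf hg ?_
      refine Eq.trans ?_ htr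
      refine Eq.trans ?_ (weightedTrace_eq_integral k0 k1 _ _).symm
      refine integral_congr_ae (Eventually.of_forall fun z => (sq_abs _).trans (sq _))
    · obtain ⟨f, h2, h3, h4⟩ := hr r
      have hcast : (B.next (T (Fin.last s)) π e).X r.castSucc =
        (B.X r).submatrix (fun l => (e l).1.2) (fun l => (e l).1.2) :=
        next_X_castSucc B _ e r
      -- An earlier template keeps its map, precomposed with `v_Y`.
      refine ⟨fun l => f (e l).1.2, ?_, h3.comp hg, ?_⟩
      · rw [hcast, h2]; rfl
      · rw [hcast, h4, ← weightedTrace_submatrix h0 h1 k0 k1 hg]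
        rfl

/-! ### The gradient of the barycenter functional -/

/-- The opposite tangent vector. -/
def TangentRep.neg {Y : Network} (v : TangentRep Y) : TangentRep Y where
  base := v.base
  mem_class := v.mem_class
  vec := fun y => -v.vec y
  memLp := v.memLp.neg

theorem pairing_neg {Y : Network} (v w : TangentRep Y) (R : CommonResolution v.base w.base) :
    pairing v.neg w R = -pairing v w R := by
  unfold pairing
  rw [← integral_neg]
  exact integral_congr_ae (Eventually.of_forall fun z => neg_mul _ _)

theorem pairing_symm {Y : Network} (v w : TangentRep Y) (R : CommonResolution v.base w.base) :
    pairing w v R.symm = pairing v w R :=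
  integral_congr_ae (Eventually.of_forall fun _ => mul_comm _ _)

/-- A directional derivative is bounded by the slope of a quadratic upper bound. -/
theorem HasDirDeriv.le_of_quadratic_bound {G : Network → ℝ} {Y : Network} {v : TangentRep Y}
    {d a b : ℝ} (h : HasDirDeriv G (Quot.mk _ v) d)
    (hb : ∀ t, 0 < t → G (expRep v t) ≤ G v.base + t * a + t ^ 2 * b) : d ≤ a := by
  -- The difference quotient is at most `a + t * b`, which tends to `a`.
  have h1 : Tendsto (fun t : ℝ => a + t * b) (𝓝[>] 0) (𝓝 (a + 0 * b)) :=
    ((continuous_const.add (continuous_id.mul continuous_const)).tendsto 0).mono_left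
      nhdsWithin_le_nhds
  rw [zero_mul, add_zero] at h1
  refine le_of_tendsto_of_tendsto (h v rfl) h1 ?_
  filter_upwards [self_mem_nhdsWithin] with t ht
  rw [Set.mem_Ioi] at ht
  rw [div_le_iff₀ ht]
  linarith [hb t ht]

theorem integrable_mul_comp_resolution {Y W : Network} (u : TangentRep Y)
    (R : CommonResolution u.base W) {g : W.carrier × W.carrier → ℝ}
    (hg : MemLp g 2 (W.μ.prod W.μ)) :
    Integrable (fun z : R.Z × R.Z => u.vec (R.φ z.1, R.φ z.2) * g (R.ψ z.1, R.ψ z.2))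
      (R.μ.prod R.μ) := by
  have h1 : MemLp (fun z : R.Z × R.Z => u.vec (R.φ z.1, R.φ z.2)) 2 (R.μ.prod R.μ) :=
    u.memLp.comp_measurePreserving (R.φ_preserving.prod R.φ_preserving)
  have h2 : MemLp (fun z : R.Z × R.Z => g (R.ψ z.1, R.ψ z.2)) 2 (R.μ.prod R.μ) :=
    hg.comp_measurePreserving (R.ψ_preserving.prod R.ψ_preserving)
  exact h1.integrable_mul h2

/-- Quadratic upper bound of `GW²` along a ray, from a coupling that is optimal at its start. -/
theorem GW_expRep_sq_le {X Y W : Network} (u : TangentRep Y) (R : CommonResolution u.base W)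
    {f : W.carrier → X.carrier} (hf : MeasurePreserving f W.μ X.μ) (t : ℝ) :
    GW X (expRep u t) ^ 2 ≤
      ∫ z, (X.ω (f z.1, f z.2) - W.ω z) ^ 2 ∂(W.μ.prod W.μ)
        + t * (2 * ∫ z, u.vec (R.φ z.1, R.φ z.2) *
          (W.ω (R.ψ z.1, R.ψ z.2) - X.ω (f (R.ψ z.1), f (R.ψ z.2))) ∂(R.μ.prod R.μ))
        + t ^ 2 * ∫ z, u.vec (R.φ z.1, R.φ z.2) ^ 2 ∂(R.μ.prod R.μ) := by
  -- The competitor is the law of `(f ∘ R.ψ, R.φ)`, the same for every `t`.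
  have hX : MeasurePreserving (f ∘ R.ψ) R.μ X.μ := hf.comp R.ψ_preserving
  have hu : MemLp (fun z : R.Z × R.Z => u.vec (R.φ z.1, R.φ z.2)) 2 (R.μ.prod R.μ) :=
    u.memLp.comp_measurePreserving (R.φ_preserving.prod R.φ_preserving)
  have hA : MemLp (fun z : W.carrier × W.carrier => X.ω (f z.1, f z.2) - W.ω z) 2
      (W.μ.prod W.μ) :=
    (X.memLp.comp_measurePreserving (hf.prod hf)).sub W.memLp
  have hR := R.ψ_preserving.prod R.ψ_preserving
  have ha : MemLp (fun z : R.Z × R.Z => X.ω (f (R.ψ z.1), f (R.ψ z.2)) -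
      W.ω (R.ψ z.1, R.ψ z.2)) 2 (R.μ.prod R.μ) := hA.comp_measurePreserving hR
  have hφ : MeasurePreserving R.φ R.μ (expRep u t).μ := R.φ_preserving
  refine (GW_sq_le (IsCoupling.of_preserving (Y := expRep u t) hX hφ)).trans (le_of_eq ?_)
  rw [distortion_map (Y := expRep u t) hX hφ, ← integral_comp_preserving hR (g := fun z => (X.ω (f z.1, f z.2) - W.ω z) ^ 2)
    (hA.1.pow 2), ← integral_const_mul, ← integral_const_mul, ← integral_const_mul]
  have hi : Integrable (fun z : R.Z × R.Z => u.vec (R.φ z.1, R.φ z.2) *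
      (W.ω (R.ψ z.1, R.ψ z.2) - X.ω (f (R.ψ z.1), f (R.ψ z.2)))) (R.μ.prod R.μ) :=
    integrable_mul_comp_resolution u R
      (W.memLp.sub (X.memLp.comp_measurePreserving (hf.prod hf)))
  refine Eq.trans ?_ ((integral_add (ha.integrable_sq.add ((hi.const_mul 2).const_mul t))
    (hu.integrable_sq.const_mul (t ^ 2))).trans ?_)
  · refine integral_congr_ae ?_
    -- On the resolution the base weight equals that of `W`, so the integrand is the square of `(X.ω
    -- - W.ω) - t * u.vec`.
    filter_upwards [R.pullback_eq] with z hz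
    simp only [expRep, sq_abs, Function.comp_apply, hz, Pi.add_apply]
    ring
  · congr 1
    exact integral_add ha.integrable_sq ((hi.const_mul 2).const_mul t)

/-- If a functional has a gradient `γ` and all its directional derivatives are bounded above by
the pairings with `w`, then the squared norm of `γ` is that of `w`. -/
theorem IsGradient.hasNormSq_of_le {G : Network → ℝ} {Y : Network} {γ : Tan Y}
    (hγ : IsGradient G Y γ) (w : TangentRep Y)
    (hw : ∀ (u : TangentRep Y) (R : CommonResolution u.base w.base) (d : ℝ),
      HasDirDeriv G (Quot.mk _ u) d → d ≤ pairing u w R) :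
    HasNormSq γ (pairing w w (CommonResolution.diagonal w.base)) := by
  obtain ⟨g, rfl⟩ := Quot.exists_rep γ
  have key : ∀ (u : TangentRep Y) (R : CommonResolution u.base w.base) (d : ℝ),
      HasInner (Quot.mk _ u) (Quot.mk _ g) d → pairing u w R = d := by
    intro u R d hd
    obtain ⟨d₁, h₁, i₁⟩ := hγ (Quot.mk _ u)
    -- The opposite direction supplies the reverse inequality, because its derivative is minus that
    -- of `u`.
    obtain ⟨d₂, h₂, i₂⟩ := hγ (Quot.mk _ u.neg)
    obtain ⟨Q⟩ : WeakIso u.base g.base := u.mem_class.trans g.mem_class.symm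
    have e := hd u g rfl rfl Q
    have e₁ := i₁ u g rfl rfl Q
    have e₂ := i₂ u.neg g rfl rfl Q
    have l₁ := hw u R d₁ h₁
    have l₂ := hw u.neg R d₂ h₂
    rw [pairing_neg] at e₂ l₂
    linarith
  obtain ⟨R⟩ : WeakIso g.base w.base := g.mem_class.trans w.mem_class.symm
  -- The gradient property in the direction `γ` itself makes `⟨γ, γ⟩` well defined; only its value
  -- remains to be found.
  obtain ⟨d, -, hd⟩ := hγ (Quot.mk _ g)
  obtain ⟨d', -, hd'⟩ := hγ (Quot.mk _ w)
  have e : pairing w w (CommonResolution.diagonal w.base) = d := by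
    rw [key w _ d' hd', ← hd' w g rfl rfl R.symm, pairing_symm, key g R d hd]
  rw [e]
  exact hd

/-- `∑ λ_s (𝐘_b - 𝐗_b^s)`, a tangent vector at the blown-up network. -/
noncomputable def BlowUpData.tangent {Y : Network} {S : ℕ} (B : BlowUpData S) (lam : Fin S → ℝ)
    (h0 : ∀ i, 0 < B.q i) (h1 : ∑ i, B.q i = 1)
    (h : WeakIso (B.toFinNetwork h0 h1).toNetwork Y) : TangentRep Y where
  base := (B.toFinNetwork h0 h1).toNetwork
  mem_class := h
  vec := fun z : Fin B.size × Fin B.size => ∑ s, lam s * (B.Y z.1 z.2 - B.X s z.1 z.2)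
  memLp := by
    have := isProbabilityMeasure_vecMeasure B.q h0 h1
    exact (MemLp.of_discrete :
      MemLp (fun z : Fin B.size × Fin B.size => ∑ s, lam s * (B.Y z.1 z.2 - B.X s z.1 z.2)) 2
        ((vecMeasure B.q).prod (vecMeasure B.q)))

/-- The bilinear expansion of the square; the signs of `𝐘_b - 𝐗_b^s` cancel in the products. -/
theorem BlowUpData.pairing_tangent {Y : Network} {S : ℕ} (B : BlowUpData S) (lam : Fin S → ℝ)
    (h0 : ∀ i, 0 < B.q i) (h1 : ∑ i, B.q i = 1)
    (h : WeakIso (B.toFinNetwork h0 h1).toNetwork Y) :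
    pairing (B.tangent lam h0 h1 h) (B.tangent lam h0 h1 h) (CommonResolution.diagonal _) =
      lam ⬝ᵥ B.gram.mulVec lam := by
  set A : Matrix (Fin B.size) (Fin B.size) ℝ :=
    Matrix.of fun i j => ∑ s, lam s * (B.Y i j - B.X s i j) with hA
  refine (weightedTrace_eq_integral h0 h1 A A).symm.trans ?_
  simp only [weightedTrace, hA, dotProduct, Matrix.mulVec, BlowUpData.gram, Matrix.of_apply,
    Matrix.sub_apply, Finset.mul_sum, Finset.sum_mul]
  have h : ∀ F : Fin S → Fin S → Fin B.size → Fin B.size → ℝ,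
      ∑ s, ∑ r, ∑ i, ∑ j, F s r i j = ∑ i, ∑ j, ∑ r, ∑ s, F s r i j := by
    intro F
    rw [Finset.sum_comm, Finset.sum_congr rfl fun _ _ => Finset.sum_comm, Finset.sum_comm]
    refine Finset.sum_congr rfl fun i _ => ?_
    rw [Finset.sum_congr rfl fun _ _ => Finset.sum_comm, Finset.sum_comm]
  rw [h]
  exact Finset.sum_congr rfl fun i _ => Finset.sum_congr rfl fun j _ =>
    Finset.sum_congr rfl fun r _ => Finset.sum_congr rfl fun s _ => by ring

end GWSpace

theorem mainTheorem5 {S : ℕ} (T : Fin S → GWSpace.FinNetwork) (lam : Fin S → ℝ)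
    (hlam : lam ∈ stdSimplex ℝ (Fin S)) (Y : GWSpace.FinNetwork) (B : GWSpace.BlowUpData S)
    (hB : GWSpace.IsOptimalBlowUp Y S T B) (γ : GWSpace.Tan Y.toNetwork)
    (hγ : GWSpace.IsGradient (GWSpace.baryFunctional T lam) Y.toNetwork γ) :
    GWSpace.HasNormSq γ (lam ⬝ᵥ B.gram.mulVec lam) := by
  open GWSpace in
  obtain ⟨h0, h1, hw, hr⟩ := hB.spec
  choose f hX hf hGW using hr
  rw [← B.pairing_tangent lam h0 h1 hw]
  refine hγ.hasNormSq_of_le (B.tangent lam h0 h1 hw) fun u R d hd => ?_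
  let W := (B.toFinNetwork h0 h1).toNetwork
  let R' : CommonResolution u.base W := R
  let I : Fin S → ℝ := fun s => ∫ z, u.vec (R'.φ z.1, R'.φ z.2) *
    (W.ω (R'.ψ z.1, R'.ψ z.2) -
      (T s).toNetwork.ω (f s (R'.ψ z.1), f s (R'.ψ z.2))) ∂(R'.μ.prod R'.μ)
  let b := ∫ z, u.vec (R'.φ z.1, R'.φ z.2) ^ 2 ∂(R'.μ.prod R'.μ)
  -- The plans along `f s` are optimal at `t = 0`, so the quadratic bound starts at the exact value
  -- of the functional.
  have hbase : ∀ s, GW (T s).toNetwork u.base ^ 2 =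
      ∫ z, ((T s).toNetwork.ω (f s z.1, f s z.2) - W.ω z) ^ 2 ∂(W.μ.prod W.μ) := by
    intro s
    rw [u.mem_class.GW_sq_eq, hGW s]
    refine (weightedTrace_eq_integral h0 h1 _ _).trans ?_
    refine integral_congr_ae (Eventually.of_forall fun z => ?_)
    rw [hX s]
    exact (sq _).symm
  have hpair : pairing u (B.tangent lam h0 h1 hw) R = ∑ s, lam s * I s := by
    simp only [I, ← integral_const_mul]
    rw [← integral_finsetSum]
    · refine integral_congr_ae (Eventually.of_forall fun z => ?_)
      simp only [BlowUpData.tangent, Finset.mul_sum, hX]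
      exact Finset.sum_congr rfl fun s _ => mul_left_comm _ _ _
    · intro s _
      exact (integrable_mul_comp_resolution u R' (W.memLp.sub
        ((T s).toNetwork.memLp.comp_measurePreserving ((hf s).prod (hf s))))).const_mul _
  rw [hpair]
  -- The factor `1 / 2` in the functional cancels the `2` in the linear term, leaving the slope `∑
  -- s, lam s * I s`.
  refine hd.le_of_quadratic_bound (b := 1 / 2 * ∑ s, lam s * b) fun t _ => ?_
  have hle : ∀ s, lam s * GW (T s).toNetwork (expRep u t) ^ 2 ≤
      lam s * (GW (T s).toNetwork u.base ^ 2 + t * (2 * I s) + t ^ 2 * b) := fun s => by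
    rw [hbase s]
    exact mul_le_mul_of_nonneg_left (GW_expRep_sq_le u R' (hf s) t) (hlam.1 s)
  calc baryFunctional T lam (expRep u t)
      ≤ 1 / 2 * ∑ s, lam s * (GW (T s).toNetwork u.base ^ 2 + t * (2 * I s) + t ^ 2 * b) :=
        mul_le_mul_of_nonneg_left (Finset.sum_le_sum fun s _ => hle s) (by norm_num)
    _ = _ := by
        simp only [baryFunctional, Finset.mul_sum, ← Finset.sum_add_distrib]
        exact Finset.sum_congr rfl fun s _ => by ring
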